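/- Let $n\ge 1$ and let $\Omega\subset\mathbb{R}^n$ be open and bounded. Let $\varphi:\Omega\times[0,\infty)\to[0,\infty]$ be a weak generalized $\Phi$-function, $\varphi\in\Phi_{\rm w}(\Omega)$, i.e. - for every measurable $f:\Omega\to\mathbb{R}$ the function $x\mapsto\varphi(x,|f(x)|)$ is measurable, and for every $x\in\Omega$ the function $t\mapsto\varphi(x,t)$ is non-decreasing; - $\varphi(x,0)=\lim_{t\to0^+}\varphi(x,t)=0$ and $\lim_{t\to\infty}\varphi(x,t)=\infty$ for every $x\in\Omega$; - there is $L\ge1$ such that $\frac{\varphi(x,s)}{s}\le L\,\frac{\varphi(x,t)}{t}$ for all $x\in\Omega$ and $0<s<t$. Write $\varphi^{-1}(x,t):=\inf\{\tau\ge0:\varphi(x,\tau)\ge t\}$ and let $|A|$ denote Lebesgue measure. Assume that $\varphi$ satisfies the following conditions. - (A0): there is $\beta\in(0,1]$ such that $\beta\le\varphi^{-1}(x,1)\le\frac1\beta$ for almost every $x\in\Omega$. - (A1): there is $\beta\in(0,1)$ such that $\beta\varphi^{-1}(x,t)\le\varphi^{-1}(y,t)$ for every ball $B\subset\mathbb{R}^n$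 with $|B|\le1$, every $t\in[1,\frac1{|B|}]$ and almost every $x,y\in B\cap\Omega$. - (aInc) for large $t$: there are $t_0\geq 0$, $p>1$ and $a\ge1$ such that $\frac{\varphi(x,t)}{t^p}\le a\,\frac{\varphi(x,s)}{s^p}$ for all $s>t\ge t_0$ with $t>0$ and almost every $x\in\Omega$. Let $L^\varphi(\Omega)$ be the set of measurable $f:\Omega\to\mathbb{R}$ with $\int_\Omega\varphi(x,\lambda|f(x)|)\,dx<\infty$ for some $\lambda>0$, let $$\|f\|_{L^\varphi(\Omega)}:=\inf\Big\{\lambda>0:\int_\Omega\varphi\Big(x,\frac{|f(x)|}{\lambda}\Big)\,dx\le1\Big\},$$ and let $$Mf(x):=\sup_{B\ni x}\frac1{|B|}\int_{B\cap\Omega}|f(y)|\,dy,$$ where the supremum is over all open balls $B\subset\mathbb{R}^n$ containing $x$. Then $M$ is bounded from $L^\varphi(\Omega)$ to $L^\varphi(\Omega)$: every $f\in L^\varphi(\Omega)$ is locally integrable in $\Omega$, $Mf$ is finite almost everywhere in $\Omega$ and belongs to $L^\varphi(\Omega)$, and there is a constant $C<\infty$, independent of $f$, with $\|Mf\|_{L^\varphi(\Omega)}\le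 C\|f\|_{L^\varphi(\Omega)}$ for all $f\in L^\varphi(\Omega)$. -/

import Mathlib

open MeasureTheory Filter Topology Set
open scoped NNReal ENNReal

namespace GenOrlicz

/-- Euclidean space `ℝⁿ`. -/
abbrev Rn (n : ℕ) : Type := EuclideanSpace ℝ (Fin n)

variable {n : ℕ}

/-- `φ ∈ Φ_w(Ω)`: a weak (generalized) `Φ`-function `φ : Ω × [0,∞) → [0,∞]`.
The function is total in `x`, but only its values at `x ∈ Ω` are ever used.
Measurability is Lebesgue measurability on `Ω`. -/
structure IsWeakPhi (Ω : Set (Rn n)) (φ : Rn n → ℝ≥0 → ℝ≥0∞) : Prop where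
  measurable_comp : ∀ f : Rn n → ℝ, AEMeasurable f (volume.restrict Ω) →
    AEMeasurable (fun x => φ x ‖f x‖₊) (volume.restrict Ω)
  mono : ∀ x ∈ Ω, Monotone (φ x)
  map_zero : ∀ x ∈ Ω, φ x 0 = 0
  tendsto_zero : ∀ x ∈ Ω, Tendsto (φ x) (𝓝[>] 0) (𝓝 0)
  tendsto_top : ∀ x ∈ Ω, Tendsto (φ x) atTop (𝓝 ∞)
  almost_increasing : ∃ L : ℝ≥0, 1 ≤ L ∧ ∀ x ∈ Ω, ∀ s t : ℝ≥0, 0 < s → s < t →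
    φ x s / (s : ℝ≥0∞) ≤ L * (φ x t / (t : ℝ≥0∞))

/-- The generalized inverse `φ⁻¹(x,t) = inf {τ ≥ 0 : φ(x,τ) ≥ t}`, with `inf ∅ = ∞`. -/
noncomputable def genInv (φ : Rn n → ℝ≥0 → ℝ≥0∞) (x : Rn n) (t : ℝ≥0∞) : ℝ≥0∞ :=
  ⨅ (τ : ℝ≥0) (_ : t ≤ φ x τ), (τ : ℝ≥0∞)

/-- Condition (A0). -/
def CondA0 (Ω : Set (Rn n)) (φ : Rn n → ℝ≥0 → ℝ≥0∞) : Prop :=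
  ∃ β : ℝ≥0, 0 < β ∧ β ≤ 1 ∧
    ∀ᵐ x ∂(volume.restrict Ω), (β : ℝ≥0∞) ≤ genInv φ x 1 ∧ genInv φ x 1 ≤ 1 / (β : ℝ≥0∞)

/-- Condition (A1). -/
def CondA1 (Ω : Set (Rn n)) (φ : Rn n → ℝ≥0 → ℝ≥0∞) : Prop :=
  ∃ β : ℝ≥0, 0 < β ∧ β < 1 ∧
    ∀ (c : Rn n) (r : ℝ), 0 < r → volume (Metric.ball c r) ≤ 1 →
      ∀ t : ℝ≥0∞, 1 ≤ t → t ≤ 1 / volume (Metric.ball c r) →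
        ∀ᵐ x ∂(volume.restrict (Metric.ball c r ∩ Ω)),
          ∀ᵐ y ∂(volume.restrict (Metric.ball c r ∩ Ω)),
            (β : ℝ≥0∞) * genInv φ x t ≤ genInv φ y t

/-- `(aInc)_p` on `A × T`. -/
def AIncOn (φ : Rn n → ℝ≥0 → ℝ≥0∞) (p : ℝ) (A : Set (Rn n)) (T : Set ℝ≥0) : Prop :=
  ∃ a : ℝ≥0, 1 ≤ a ∧ ∀ t ∈ T, ∀ s ∈ T, t < s → ∀ᵐ x ∂(volume.restrict A),
    φ x t / (t : ℝ≥0∞) ^ p ≤ a * (φ x s / (s : ℝ≥0∞) ^ p)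

/-- (aInc) for large `t`: for some `p > 1` and some `t₀`, `(aInc)_p` holds on `Ω × [t₀,∞)`. -/
def AIncInfty (Ω : Set (Rn n)) (φ : Rn n → ℝ≥0 → ℝ≥0∞) : Prop :=
  ∃ t₀ : ℝ≥0, ∃ p : ℝ, 1 < p ∧ AIncOn φ p Ω (Ici t₀)

/-- The modular `∫_Ω φ(x, |f(x)|) dx`. -/
noncomputable def modular (Ω : Set (Rn n)) (φ : Rn n → ℝ≥0 → ℝ≥0∞) (f : Rn n → ℝ) : ℝ≥0∞ :=
  ∫⁻ x in Ω, φ x ‖f x‖₊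

/-- `f ∈ L^φ(Ω)`: `f` is measurable on `Ω` and `∫_Ω φ(x, λ|f(x)|) dx < ∞` for some `λ > 0`. -/
def MemLphi (Ω : Set (Rn n)) (φ : Rn n → ℝ≥0 → ℝ≥0∞) (f : Rn n → ℝ) : Prop :=
  AEMeasurable f (volume.restrict Ω) ∧
    ∃ lam : ℝ, 0 < lam ∧ modular Ω φ (fun x => lam * f x) < ∞

/-- The Luxemburg (quasi)norm `inf {λ > 0 : ∫_Ω φ(x, |f(x)|/λ) dx ≤ 1}`, with `inf ∅ = ∞`. -/
noncomputable def lphiNorm (Ω : Set (Rn n)) (φ : Rn n → ℝ≥0 → ℝ≥0∞) (f : Rn n → ℝ) : ℝ≥0∞ :=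
  ⨅ (lam : ℝ≥0) (_ : 0 < lam) (_ : modular Ω φ (fun x => f x / (lam : ℝ)) ≤ 1), (lam : ℝ≥0∞)

/-- The non-centred Hardy–Littlewood maximal function on `Ω`: the supremum of
`|B|⁻¹ ∫_{B ∩ Ω} |f|` over all open balls `B` of `ℝⁿ` that contain `x`. -/
noncomputable def maximalFn (Ω : Set (Rn n)) (f : Rn n → ℝ) (x : Rn n) : ℝ≥0∞ :=
  ⨆ (c : Rn n) (r : ℝ) (_ : x ∈ Metric.ball c r),
    (volume (Metric.ball c r))⁻¹ * ∫⁻ y in Metric.ball c r ∩ Ω, ‖f y‖ₑ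

/-- `M : L^φ(Ω) → L^φ(Ω)` is well defined and bounded: every `f ∈ L^φ(Ω)` is in `L¹_loc(Ω)`,
`Mf` is finite almost everywhere in `Ω` and lies in `L^φ(Ω)`, and `‖Mf‖ ≤ C ‖f‖` with `C < ∞`
independent of `f`. -/
def MaximalBounded (Ω : Set (Rn n)) (φ : Rn n → ℝ≥0 → ℝ≥0∞) : Prop :=
  ∃ C : ℝ≥0, ∀ f : Rn n → ℝ, MemLphi Ω φ f →
    LocallyIntegrableOn f Ω volume ∧
    (∀ᵐ x ∂(volume.restrict Ω), maximalFn Ω f x < ∞) ∧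
    MemLphi Ω φ (fun x => (maximalFn Ω f x).toReal) ∧
    lphiNorm Ω φ (fun x => (maximalFn Ω f x).toReal) ≤ C * lphiNorm Ω φ f

end GenOrlicz

/-! By scaling it is enough to bound the modular of `θ * Mf` when the modular of `f` is at most 1.
The core is a Jensen-type inequality (`ae_le_of_mul_lt_average`). Let `B` be a ball with `|B| ≤ 1`,
let `A` be the average over `B` of `φ(y,|f(y)|)^(1/p)`, extended by zero outside `Ω`, and put `t =
max(1, A^p)`. Ordinary Jensen and the modular bound give `t ≤ 1/|B|`, so (A1) makes the values
`φ⁻¹(y,t)` comparable for almost all `y ∈ B ∩ Ω`. Then (aInc) bounds `|f(y)|` by a multiple of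
`φ⁻¹(x,t) * (1 + t^(-1/p) * φ(y,|f(y)|)^(1/p))`, with `t₀` absorbed through (A0). Averaging, the
mean of `|f|` is at most a multiple of `φ⁻¹(x,t)`, so `φ(x, ·)` at a small multiple of that mean is
at most `1 + A^p`.

Taking the supremum over balls gives `φ(x, k * Mf(x)) ≤ 1 + (M_R g(x))^p` with `g = φ(·,|f|)^(1/p)`
on `Ω`; balls of radius above `R` only cost the constant 1, because the modular controls the `L¹`
norm. Since `∫ g^p` is the modular of `f`, `strong_type` bounds the integral by `|Ω| + C`, and
almost monotonicity of `φ(x,s)/s` rescales this to 1.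

Exceptional null sets depend on the ball and on `t` in (A1), and on the pair of arguments in (aInc).
Countable dense families of balls and of arguments make them uniform, at the price of constants. -/

namespace GenOrlicz

variable {n : ℕ}

/-! ### Weak and strong type estimates for the maximal function over bounded radii -/

/-- The maximal function restricted to balls of radius at most `R`. -/
noncomputable def localMax (R : ℝ) (g : Rn n → ℝ≥0∞) (x : Rn n) : ℝ≥0∞ :=
  ⨆ (c : Rn n) (r : ℝ) (_ : r ≤ R) (_ : x ∈ Metric.ball c r),
    (volume (Metric.ball c r))⁻¹ * ∫⁻ y in Metric.ball c r, g y

lemma lt_localMax_iff {R : ℝ} {g : Rn n → ℝ≥0∞} {x : Rn n} {l : ℝ≥0∞} :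
    l < localMax R g x ↔ ∃ (c : Rn n) (r : ℝ), r ≤ R ∧ x ∈ Metric.ball c r ∧
      l < (volume (Metric.ball c r))⁻¹ * ∫⁻ y in Metric.ball c r, g y := by
  simp only [localMax, lt_iSup_iff, exists_prop]

lemma le_localMax {R : ℝ} (g : Rn n → ℝ≥0∞) {x c : Rn n} {r : ℝ} (hr : r ≤ R)
    (hx : x ∈ Metric.ball c r) :
    (volume (Metric.ball c r))⁻¹ * ∫⁻ y in Metric.ball c r, g y ≤ localMax R g x :=
  le_iSup₂_of_le c r (le_iSup₂_of_le hr hx le_rfl)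

/-- Superlevel sets are unions of open balls, so no measurability of `g` is needed. -/
lemma measurable_localMax (R : ℝ) (g : Rn n → ℝ≥0∞) : Measurable (localMax R g) := by
  refine measurable_of_Ioi fun l => (IsOpen.measurableSet ?_)
  rw [isOpen_iff_mem_nhds]
  intro x hx
  obtain ⟨c, r, hr, hxc, h⟩ := lt_localMax_iff.1 hx
  filter_upwards [Metric.isOpen_ball.mem_nhds hxc] with y hy
  exact lt_localMax_iff.2 ⟨c, r, hr, hy, h⟩

lemma volume_ball_eq (c : Rn n) {r : ℝ} (hr : 0 < r) :
    volume (Metric.ball c r) = ENNReal.ofReal (r ^ n) * volume (Metric.ball (0 : Rn n) 1) := by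
  simpa using Measure.addHaar_ball_of_pos (volume : Measure (Rn n)) c hr

lemma volume_closedBall_eq (c : Rn n) {r s : ℝ} (hr : 0 < r) (hs : 0 < s) :
    volume (Metric.closedBall c (s * r)) =
      ENNReal.ofReal (s ^ n) * volume (Metric.ball c r) := by
  have h := Measure.addHaar_closedBall (volume : Measure (Rn n)) c (mul_pos hs hr).le
  rw [h, volume_ball_eq c hr, ← mul_assoc, ← ENNReal.ofReal_mul (by positivity)]
  simp [mul_pow]

lemma volume_ball_ne_zero (c : Rn n) {r : ℝ} (hr : 0 < r) : volume (Metric.ball c r) ≠ 0 :=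
  (Metric.measure_ball_pos volume c hr).ne'

lemma volume_ball_ne_top (c : Rn n) (r : ℝ) : volume (Metric.ball c r) ≠ ∞ :=
  measure_ball_lt_top.ne

lemma localMax_add_le (R : ℝ) {g h : Rn n → ℝ≥0∞} (k : ℝ≥0∞)
    (hk : ∀ x, h x ≤ g x + k) (x : Rn n) : localMax R h x ≤ localMax R g x + k := by
  refine iSup₂_le fun c r => iSup₂_le fun hr hx => ?_
  have hr0 : 0 < r := Metric.pos_of_mem_ball hx
  calc _ ≤ (volume (Metric.ball c r))⁻¹ * ∫⁻ y in Metric.ball c r, (g y + k) := by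
        gcongr with y; exact hk y
    _ = (volume (Metric.ball c r))⁻¹ * (∫⁻ y in Metric.ball c r, g y) + k := by
        rw [lintegral_add_right _ measurable_const, mul_add]
        congr 1
        rw [setLIntegral_const, mul_comm k, ← mul_assoc,
          ENNReal.inv_mul_cancel (volume_ball_ne_zero c hr0) (volume_ball_ne_top c r), one_mul]
    _ ≤ _ := by gcongr; exact le_localMax g hr hx

/-- The weak type `(1,1)` estimate. -/
lemma weak_type (R : ℝ) (g : Rn n → ℝ≥0∞) (l : ℝ≥0∞) :
    l * volume {x | l < localMax R g x} ≤ ENNReal.ofReal (5 ^ n) * ∫⁻ y, g y := by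
  -- Vitali covering applies because the radii are bounded by `R`. The fivefold enlargements of a
  -- disjoint subfamily cover the superlevel set, which is where `5 ^ n` comes from.
  let t : Set (Rn n × ℝ) := {q | q.2 ≤ R ∧ 0 < q.2 ∧
    l * volume (Metric.ball q.1 q.2) ≤ ∫⁻ y in Metric.ball q.1 q.2, g y}
  obtain ⟨u, hut, hud, hu⟩ := Vitali.exists_disjoint_subfamily_covering_enlargement_closedBall t
    (fun q => q.1) (fun q => q.2) R (fun a ha => ha.1) 5 (by norm_num)
  have hudb : u.PairwiseDisjoint fun q => Metric.ball q.1 q.2 :=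
    hud.mono fun q => Metric.ball_subset_closedBall
  have huc : u.Countable := hudb.countable_of_isOpen (fun _ _ => Metric.isOpen_ball)
    fun q hq => Metric.nonempty_ball.2 (hut hq).2.1
  have hsub : {x | l < localMax R g x} ⊆ ⋃ q ∈ u, Metric.closedBall q.1 (5 * q.2) := by
    intro x hx
    obtain ⟨c, r, hr, hxc, h⟩ := lt_localMax_iff.1 hx
    have hr0 : 0 < r := Metric.pos_of_mem_ball hxc
    have hct : (c, r) ∈ t := by
      refine ⟨hr, hr0, ?_⟩
      have := h.le
      rwa [← ENNReal.div_eq_inv_mul, ENNReal.le_div_iff_mul_le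
        (Or.inl (volume_ball_ne_zero c hr0)) (Or.inl (volume_ball_ne_top c r))] at this
    obtain ⟨b, hb, hsb⟩ := hu _ hct
    exact mem_biUnion hb (hsb (Metric.ball_subset_closedBall hxc))
  calc l * volume {x | l < localMax R g x}
      ≤ l * ∑' q : u, volume (Metric.closedBall q.1.1 (5 * q.1.2)) := by
        gcongr
        exact (measure_mono hsub).trans (measure_biUnion_le volume huc _)
    _ = ∑' q : u, ENNReal.ofReal (5 ^ n) * (l * volume (Metric.ball q.1.1 q.1.2)) := by
        rw [← ENNReal.tsum_mul_left]
        refine tsum_congr fun q => ?_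
        rw [volume_closedBall_eq _ (hut q.2).2.1 (by norm_num)]
        ring
    _ ≤ ∑' q : u, ENNReal.ofReal (5 ^ n) * ∫⁻ y in Metric.ball q.1.1 q.1.2, g y := by
        gcongr with q
        exact (hut q.2).2.2
    _ = ENNReal.ofReal (5 ^ n) * ∫⁻ y in ⋃ q ∈ u, Metric.ball q.1 q.2, g y := by
        rw [ENNReal.tsum_mul_left,
          lintegral_biUnion huc (fun _ _ => Metric.isOpen_ball.measurableSet) hudb]
    _ ≤ _ := by gcongr; exact Measure.restrict_le_self

/-- If the infinity set had positive measure, the weak type bound would fail at a large enough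
natural level. -/
lemma ae_localMax_lt_top (R : ℝ) {g : Rn n → ℝ≥0∞} (hg : ∫⁻ y, g y ≠ ∞) :
    ∀ᵐ x, localMax R g x < ∞ := by
  have h0 : volume {x | localMax R g x = ∞} = 0 := by
    by_contra h
    have hC : ENNReal.ofReal (5 ^ n) * ∫⁻ y, g y ≠ ∞ := ENNReal.mul_ne_top ENNReal.ofReal_ne_top hg
    obtain ⟨k, hk⟩ := ENNReal.exists_nat_mul_gt h hC
    have := weak_type R g k
    have h2 : volume {x | localMax R g x = ∞} ≤ volume {x | (k : ℝ≥0∞) < localMax R g x} :=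
      measure_mono fun x (hx : _ = _) => by
        simp only [mem_ofPred_eq, hx]; exact ENNReal.natCast_lt_top k
    exact absurd (hk.trans_le ((mul_le_mul_right h2 _).trans this)) (lt_irrefl _)
  filter_upwards [measure_eq_zero_iff_ae_notMem.1 h0] with x hx
  exact lt_top_iff_ne_top.2 hx

/-- Marcinkiewicz truncation: the part of `g` below `s / 2` contributes at most `s / 2` to the
maximal function, so the weak type bound is needed only for the rest. The right side is a
distribution function for the measure `g dx`, ready for a second layer-cake formula. -/
lemma meas_lt_localMax_le (R : ℝ) {g : Rn n → ℝ≥0∞} (hg : Measurable g) {s : ℝ} (hs : 0 < s) :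
    volume {x | s < (localMax R g x).toReal} ≤
      2 * ENNReal.ofReal (5 ^ n) * (ENNReal.ofReal s)⁻¹ *
        (volume.withDensity g) {x | s < (2 * g x).toReal ∨ g x = ∞} := by
  -- The clause `g x = ∞` is needed because `toReal` sends `∞` to 0.
  set S : Set (Rn n) := {x | s < (2 * g x).toReal ∨ g x = ∞} with hS
  have hSm : MeasurableSet S :=
    (measurableSet_lt measurable_const (hg.const_mul 2).ennreal_toReal).union
      (hg (measurableSet_singleton _))
  have hle : ∀ x, g x ≤ S.indicator g x + ENNReal.ofReal (s / 2) := by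
    intro x
    by_cases hx : x ∈ S
    · simp [hx]
    · simp only [hS, mem_ofPred_eq, not_or, not_lt] at hx
      refine le_add_left ?_
      rw [ENNReal.le_ofReal_iff_toReal_le hx.2 (by positivity)]
      have := hx.1
      rw [ENNReal.toReal_mul] at this
      norm_num at this
      linarith
  have hsub : {x | s < (localMax R g x).toReal} ⊆
      {x | ENNReal.ofReal (s / 2) < localMax R (S.indicator g) x} := by
    intro x hx
    have h1 : ENNReal.ofReal s < localMax R g x := ENNReal.ofReal_lt_iff_lt_toReal hs.le
      (fun h => by simp [h] at hx; linarith) |>.2 hx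
    have h2 := h1.trans_le (localMax_add_le R _ hle x)
    have h3 : ENNReal.ofReal s = ENNReal.ofReal (s / 2) + ENNReal.ofReal (s / 2) := by
      rw [← ENNReal.ofReal_add (by positivity) (by positivity), add_halves]
    rw [h3] at h2
    exact lt_of_add_lt_add_right h2
  have hw := weak_type R (S.indicator g) (ENNReal.ofReal (s / 2))
  rw [lintegral_indicator hSm, ← withDensity_apply g hSm] at hw
  have hs2 : ENNReal.ofReal (s / 2) = ENNReal.ofReal s / 2 := by
    rw [ENNReal.ofReal_div_of_pos (by norm_num)]; norm_num
  have hs0 : ENNReal.ofReal s ≠ 0 := by simpa using hs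
  calc volume {x | s < (localMax R g x).toReal}
      ≤ volume {x | ENNReal.ofReal (s / 2) < localMax R (S.indicator g) x} := measure_mono hsub
    _ = 2 * (ENNReal.ofReal s)⁻¹ * (ENNReal.ofReal (s / 2) *
          volume {x | ENNReal.ofReal (s / 2) < localMax R (S.indicator g) x}) := by
        rw [hs2, ← mul_assoc, div_eq_mul_inv, mul_comm (ENNReal.ofReal s), mul_mul_mul_comm,
          ENNReal.mul_inv_cancel (by norm_num) (by norm_num),
          ENNReal.inv_mul_cancel hs0 ENNReal.ofReal_ne_top, one_mul, one_mul]
    _ ≤ 2 * (ENNReal.ofReal s)⁻¹ * (ENNReal.ofReal (5 ^ n) * (volume.withDensity g) S) := by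
        gcongr
    _ = _ := by ring

/-- The strong type `(p,p)` estimate for integrable functions. -/
lemma strong_type {p : ℝ} (hp : 1 < p) : ∃ C : ℝ≥0, ∀ (R : ℝ) (g : Rn n → ℝ≥0∞),
    AEMeasurable g → ∫⁻ y, g y ≠ ∞ →
    ∫⁻ x, localMax R g x ^ p ≤ C * ∫⁻ x, g x ^ p := by
  have hp1 : 0 < p - 1 := by linarith
  have hp0 : 0 < p := by linarith
  have hmeas : ∀ (R : ℝ) (g : Rn n → ℝ≥0∞), Measurable g → ∫⁻ y, g y ≠ ∞ →
      ∫⁻ x, localMax R g x ^ p ≤ (ENNReal.ofReal p * (2 * ENNReal.ofReal (5 ^ n)) *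
        ((ENNReal.ofReal (p - 1))⁻¹ * 2 ^ (p - 1))) * ∫⁻ x, g x ^ p := by
    intro R g hg hgi
    have hgt : ∀ᵐ x, g x < ∞ := ae_lt_top hg hgi
    have hν : ∀ᵐ x ∂(volume.withDensity g), g x < ∞ := withDensity_absolutelyContinuous _ _ hgt
    have h1 : ∫⁻ x, localMax R g x ^ p = ∫⁻ x, ENNReal.ofReal ((localMax R g x).toReal ^ p) := by
      refine lintegral_congr_ae ?_
      filter_upwards [ae_localMax_lt_top R hgi] with x hx
      rw [← ENNReal.ofReal_rpow_of_nonneg ENNReal.toReal_nonneg hp0.le, ENNReal.ofReal_toReal hx.ne]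
    -- Layer cake with exponent `p - 1` for the measure `g dx` recovers `∫ g^p`, since one factor
    -- `g` sits in the measure.
    have h2 : ∫⁻ x, ENNReal.ofReal ((2 * g x).toReal ^ (p - 1)) ∂(volume.withDensity g) =
        2 ^ (p - 1) * ∫⁻ x, g x ^ p := by
      rw [lintegral_withDensity_eq_lintegral_mul _ hg
        ((hg.const_mul 2).ennreal_toReal.pow_const _).ennreal_ofReal,
        ← lintegral_const_mul _ (hg.pow_const _)]
      refine lintegral_congr_ae ?_
      filter_upwards [hgt] with x hx
      simp only [Pi.mul_apply]
      rw [← ENNReal.ofReal_rpow_of_nonneg ENNReal.toReal_nonneg hp1.le,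
        ENNReal.ofReal_toReal (ENNReal.mul_ne_top (by norm_num) hx.ne),
        ENNReal.mul_rpow_of_nonneg _ _ hp1.le, mul_left_comm]
      congr 1
      conv_lhs => rw [← ENNReal.rpow_one (g x), ← ENNReal.rpow_mul, one_mul]
      rw [← ENNReal.rpow_add_of_nonneg _ _ zero_le_one hp1.le, add_sub_cancel]
    have h3 := lintegral_rpow_eq_lintegral_meas_lt_mul (volume.withDensity g)
      (f := fun x => (2 * g x).toReal) (Eventually.of_forall fun _ => ENNReal.toReal_nonneg)
      (hg.const_mul 2).ennreal_toReal.aemeasurable hp1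
    rw [h1, lintegral_rpow_eq_lintegral_meas_lt_mul volume
      (Eventually.of_forall fun _ => ENNReal.toReal_nonneg)
      (measurable_localMax R g).ennreal_toReal.aemeasurable hp0]
    have h4 : ∫⁻ s in Ioi (0 : ℝ), volume {x | s < (localMax R g x).toReal} *
          ENNReal.ofReal (s ^ (p - 1)) ≤
        2 * ENNReal.ofReal (5 ^ n) * ∫⁻ s in Ioi (0 : ℝ), (volume.withDensity g)
          {x | s < (2 * g x).toReal} * ENNReal.ofReal (s ^ (p - 1 - 1)) := by
      rw [← lintegral_const_mul' _ _ (ENNReal.mul_ne_top (by norm_num) ENNReal.ofReal_ne_top)]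
      refine setLIntegral_mono' measurableSet_Ioi fun s hs => ?_
      have hs : 0 < s := hs
      have e1 : (volume.withDensity g) {x | s < (2 * g x).toReal ∨ g x = ∞} =
          (volume.withDensity g) {x | s < (2 * g x).toReal} := by
        refine measure_congr ?_
        filter_upwards [hν] with x hx
        simp only [eq_iff_iff]
        change (s < (2 * g x).toReal ∨ g x = ∞) ↔ s < (2 * g x).toReal
        simp [hx.ne]
      have e2 : ENNReal.ofReal (s ^ (p - 1 - 1)) =
          (ENNReal.ofReal s)⁻¹ * ENNReal.ofReal (s ^ (p - 1)) := by
        rw [← ENNReal.ofReal_inv_of_pos hs, ← ENNReal.ofReal_mul (by positivity),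
          Real.rpow_sub_one hs.ne', inv_mul_eq_div]
      calc _ ≤ (2 * ENNReal.ofReal (5 ^ n) * (ENNReal.ofReal s)⁻¹ *
            (volume.withDensity g) {x | s < (2 * g x).toReal ∨ g x = ∞}) *
              ENNReal.ofReal (s ^ (p - 1)) := by
            gcongr; exact meas_lt_localMax_le R hg hs
        _ = _ := by rw [e1, e2]; ring
    rw [h2] at h3
    have h5 : ∫⁻ s in Ioi (0 : ℝ), (volume.withDensity g)
          {x | s < (2 * g x).toReal} * ENNReal.ofReal (s ^ (p - 1 - 1)) =
        (ENNReal.ofReal (p - 1))⁻¹ * (2 ^ (p - 1) * ∫⁻ x, g x ^ p) := by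
      rw [h3, ← mul_assoc, ENNReal.inv_mul_cancel (by simpa using hp1) ENNReal.ofReal_ne_top,
        one_mul]
    rw [h5] at h4
    calc _ ≤ ENNReal.ofReal p * (2 * ENNReal.ofReal (5 ^ n) *
          ((ENNReal.ofReal (p - 1))⁻¹ * (2 ^ (p - 1) * ∫⁻ x, g x ^ p))) := by gcongr
      _ = _ := by ring
  have hC : ENNReal.ofReal p * (2 * ENNReal.ofReal (5 ^ n)) *
        ((ENNReal.ofReal (p - 1))⁻¹ * 2 ^ (p - 1)) ≠ ∞ := by
    have : (2 : ℝ≥0∞) ^ (p - 1) ≠ ∞ := ENNReal.rpow_ne_top_of_nonneg hp1.le (by norm_num)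
    have h' : (ENNReal.ofReal (p - 1))⁻¹ ≠ ∞ := by simpa using hp1
    exact ENNReal.mul_ne_top (ENNReal.mul_ne_top ENNReal.ofReal_ne_top
      (ENNReal.mul_ne_top (by norm_num) ENNReal.ofReal_ne_top)) (ENNReal.mul_ne_top h' this)
  refine ⟨(ENNReal.ofReal p * (2 * ENNReal.ofReal (5 ^ n)) *
      ((ENNReal.ofReal (p - 1))⁻¹ * 2 ^ (p - 1))).toNNReal, fun R g hg hgi => ?_⟩
  have h0 : localMax R g = localMax R (hg.mk g) := by
    funext x
    simp only [localMax]
    congr! 7 with c r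
    exact lintegral_congr_ae (ae_restrict_of_ae hg.ae_eq_mk)
  have h1 : ∫⁻ x, g x ^ p = ∫⁻ x, hg.mk g x ^ p :=
    lintegral_congr_ae (hg.ae_eq_mk.mono fun x hx => by simp only [hx])
  rw [h0, h1, ENNReal.coe_toNNReal hC]
  exact hmeas R _ hg.measurable_mk (by rwa [← lintegral_congr_ae hg.ae_eq_mk])

/-! ### Jensen's inequality and symmetry of almost everywhere comparison -/

/-- An averaged form of Jensen's inequality for powers. -/
lemma rpow_average_le {α : Type*} [MeasurableSpace α] (μ : Measure α) [IsFiniteMeasure μ]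
    (h0 : μ univ ≠ 0) {p : ℝ} (hp : 1 < p) {g : α → ℝ≥0∞} (hg : AEMeasurable g μ) :
    ((μ univ)⁻¹ * ∫⁻ x, g x ∂μ) ^ p ≤ (μ univ)⁻¹ * ∫⁻ x, g x ^ p ∂μ := by
  have hp0 : 0 < p := by linarith
  have hq : 0 ≤ 1 - 1 / p := by
    rw [sub_nonneg, div_le_one hp0]; exact hp.le
  -- Hölder's inequality against the constant 1.
  have h := ENNReal.lintegral_mul_norm_pow_le (μ := μ) (hg.pow_const p)
    (aemeasurable_const (b := (1 : ℝ≥0∞))) (p := 1 / p) (q := 1 - 1 / p) (by positivity) hq (by ring)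
  simp only [ENNReal.one_rpow, mul_one, lintegral_const, one_mul] at h
  simp_rw [← ENNReal.rpow_mul, mul_one_div_cancel hp0.ne', ENNReal.rpow_one] at h
  have ht : μ univ ≠ ∞ := measure_ne_top μ univ
  calc _ ≤ ((μ univ)⁻¹ * ((∫⁻ x, g x ^ p ∂μ) ^ (1 / p) * μ univ ^ (1 - 1 / p))) ^ p := by gcongr
    _ = ((μ univ)⁻¹ ^ p * μ univ ^ (p - 1)) * ∫⁻ x, g x ^ p ∂μ := by
      rw [ENNReal.mul_rpow_of_nonneg _ _ hp0.le, ENNReal.mul_rpow_of_nonneg _ _ hp0.le,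
        ← ENNReal.rpow_mul, ← ENNReal.rpow_mul, one_div_mul_cancel hp0.ne', ENNReal.rpow_one,
        sub_mul, one_div_mul_cancel hp0.ne', one_mul]
      ring
    _ = _ := by
      congr 1
      rw [ENNReal.inv_rpow, ← ENNReal.rpow_neg, ← ENNReal.rpow_add _ _ h0 ht,
        ← ENNReal.rpow_neg_one]
      congr 1; ring

/-- Both quantifiers are separated by the essential infimum, which lies between the two sides. This
avoids Fubini, hence any measurability of `g`; it is applied to `φ⁻¹(·,t)`. -/
lemma ae_ae_mul_le_swap {α : Type*} [MeasurableSpace α] {μ : Measure α} {g : α → ℝ≥0∞}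
    {b : ℝ≥0∞} (h : ∀ᵐ x ∂μ, ∀ᵐ y ∂μ, b * g x ≤ g y) :
    ∀ᵐ x ∂μ, ∀ᵐ y ∂μ, b * g y ≤ g x := by
  have h1 : ∀ᵐ y ∂μ, b * g y ≤ essInf g μ := h.mono fun x hx => le_essInf_of_ae_le _ hx
  filter_upwards [ae_essInf_le (f := g) (μ := μ)] with x hx
  filter_upwards [h1] with y hy
  exact hy.trans hx

/-! ### The generalized inverse, almost uniform growth and the `L¹` bound -/

section Inverse

variable {φ : Rn n → ℝ≥0 → ℝ≥0∞} {x : Rn n}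

lemma lt_of_lt_genInv {t : ℝ≥0∞} {τ : ℝ≥0} (h : (τ : ℝ≥0∞) < genInv φ x t) : φ x τ < t := by
  by_contra! h'
  exact absurd (h.trans_le (iInf₂_le τ h')) (lt_irrefl _)

lemma le_of_genInv_lt (hm : Monotone (φ x)) {t : ℝ≥0∞} {τ : ℝ≥0} (h : genInv φ x t < τ) :
    t ≤ φ x τ := by
  simp only [genInv, iInf_lt_iff] at h
  obtain ⟨s, hs, hlt⟩ := h
  exact hs.trans (hm (by exact_mod_cast hlt.le))

lemma genInv_mono {t t' : ℝ≥0∞} (h : t ≤ t') : genInv φ x t ≤ genInv φ x t' :=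
  le_iInf₂ fun τ hτ => iInf₂_le τ (h.trans hτ)

lemma genInv_ne_top (hx : Tendsto (φ x) atTop (𝓝 ∞)) {t : ℝ≥0∞} (ht : t ≠ ∞) :
    genInv φ x t ≠ ∞ := by
  obtain ⟨τ, hτ⟩ := (hx.eventually (lt_mem_nhds (lt_top_iff_ne_top.2 ht))).exists
  exact ((iInf₂_le τ hτ.le).trans_lt ENNReal.coe_lt_top).ne

end Inverse

/-- The null set in (aInc) depends on the two arguments. Over a countable dense set it can be chosen
once, and monotonicity of `φ x` passes to all arguments. -/
lemma ae_aInc {Ω : Set (Rn n)} (hΩ : MeasurableSet Ω) {φ : Rn n → ℝ≥0 → ℝ≥0∞}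
    (hφ : IsWeakPhi Ω φ) {p : ℝ} (hp : 0 < p) {t₀ : ℝ≥0} (h : AIncOn φ p Ω (Ici t₀)) :
    ∃ a : ℝ≥0, ∀ᵐ x ∂(volume.restrict Ω), ∀ t s : ℝ≥0, t₀ ≤ t → 0 < t → t < s →
      φ x t * (s : ℝ≥0∞) ^ p ≤ a * (φ x s * (t : ℝ≥0∞) ^ p) := by
  obtain ⟨a, -, ha⟩ := h
  obtain ⟨D, hDc, hD⟩ := TopologicalSpace.exists_countable_dense ℝ≥0
  have hae : ∀ᵐ x ∂(volume.restrict Ω), ∀ t ∈ D, ∀ s ∈ D, t₀ ≤ t → t < s →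
      φ x t / (t : ℝ≥0∞) ^ p ≤ a * (φ x s / (s : ℝ≥0∞) ^ p) := by
    rw [ae_ball_iff hDc]
    intro t ht
    rw [ae_ball_iff hDc]
    intro s hs
    by_cases h1 : t₀ ≤ t ∧ t < s
    · exact (ha t h1.1 s (h1.1.trans h1.2.le) h1.2).mono fun x hx _ _ => hx
    · exact Eventually.of_forall fun x h2 h3 => absurd ⟨h2, h3⟩ h1
  -- The dense points are chosen with `t < t' < 2t` and `s/2 < s' < s`; each replacement costs `2 ^
  -- p`.
  refine ⟨a * 4 ^ p, ?_⟩
  filter_upwards [hae, ae_restrict_mem hΩ] with x hx hxΩ t s ht0 ht hts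
  have hm := hφ.mono x hxΩ
  obtain ⟨t', ht'D, ht'⟩ := hD.exists_between
    (lt_min hts (show t < 2 * t by rw [two_mul]; exact lt_add_of_pos_left t ht))
  have hs0 : 0 < s := ht.trans hts
  obtain ⟨s', hs'D, hs'⟩ := hD.exists_between
    (max_lt (ht'.2.trans_le (min_le_left _ _)) (NNReal.half_lt_self hs0.ne'))
  have h1 := hx t' ht'D s' hs'D (ht0.trans ht'.1.le) ((le_max_left _ _).trans_lt hs'.1)
  have hs'0 : 0 < s' := (ht.trans ht'.1).trans ((le_max_left _ _).trans_lt hs'.1)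
  have hcoe : ∀ r : ℝ≥0, 0 < r → (r : ℝ≥0∞) ^ p ≠ 0 ∧ (r : ℝ≥0∞) ^ p ≠ ∞ := fun r hr =>
    ⟨(ENNReal.rpow_pos (by exact_mod_cast hr) ENNReal.coe_ne_top).ne',
      ENNReal.rpow_ne_top_of_nonneg hp.le ENNReal.coe_ne_top⟩
  obtain ⟨ha1, ha2⟩ := hcoe t' (ht.trans ht'.1)
  obtain ⟨hb1, hb2⟩ := hcoe s' hs'0
  have h2 : φ x t' * (s' : ℝ≥0∞) ^ p ≤ a * (φ x s' * (t' : ℝ≥0∞) ^ p) := by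
    rw [ENNReal.div_le_iff ha1 ha2] at h1
    calc _ ≤ (a * (φ x s' / (s' : ℝ≥0∞) ^ p) * (t' : ℝ≥0∞) ^ p) * (s' : ℝ≥0∞) ^ p := by gcongr
      _ = a * ((φ x s' / (s' : ℝ≥0∞) ^ p * (s' : ℝ≥0∞) ^ p) * (t' : ℝ≥0∞) ^ p) := by ring
      _ = _ := by rw [ENNReal.div_mul_cancel hb1 hb2]
  have e1 : s ≤ 2 * s' := by
    have := ((le_max_right _ _).trans_lt hs'.1).le
    rw [div_le_iff₀ (by norm_num)] at this
    rwa [mul_comm]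
  have e2 : t' ≤ 2 * t := (ht'.2.trans_le (min_le_right _ _)).le
  have h4 : ((4 ^ p : ℝ≥0) : ℝ≥0∞) = 2 ^ p * 2 ^ p := by
    rw [← ENNReal.mul_rpow_of_nonneg _ _ hp.le, ENNReal.coe_rpow_of_nonneg _ hp.le]
    norm_num
  calc φ x t * (s : ℝ≥0∞) ^ p ≤ φ x t' * ((2 : ℝ≥0∞) * s') ^ p := by
        gcongr
        · exact hm ht'.1.le
        · exact_mod_cast e1
    _ = 2 ^ p * (φ x t' * (s' : ℝ≥0∞) ^ p) := by
        rw [ENNReal.mul_rpow_of_nonneg _ _ hp.le]; ring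
    _ ≤ 2 ^ p * (a * (φ x s * ((2 : ℝ≥0∞) * t) ^ p)) := by
        refine mul_le_mul_right (h2.trans ?_) _
        gcongr
        · exact hm hs'.2.le
        · exact_mod_cast e2
    _ = _ := by
        rw [ENNReal.coe_mul, h4, ENNReal.mul_rpow_of_nonneg _ _ hp.le]; ring

/-- On a set of finite measure the modular controls the `L¹` norm. -/
lemma lintegral_enorm_le_of_modular_le_one {Ω : Set (Rn n)} (hΩ : MeasurableSet Ω)
    (hΩt : volume Ω ≠ ∞) {φ : Rn n → ℝ≥0 → ℝ≥0∞} (hφ : IsWeakPhi Ω φ) (hA0 : CondA0 Ω φ) :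
    ∃ C : ℝ≥0, ∀ f : Rn n → ℝ, modular Ω φ f ≤ 1 → ∫⁻ y in Ω, ‖f y‖ₑ ≤ C := by
  obtain ⟨b, hb0, -, hb⟩ := hA0
  obtain ⟨L, -, hL⟩ := hφ.almost_increasing
  set K : ℝ≥0 := 2 / b with hK
  have hK0 : 0 < K := by positivity
  refine ⟨K * (volume Ω).toNNReal + K * L, fun f hf => ?_⟩
  have hpt : ∀ᵐ y ∂(volume.restrict Ω), ‖f y‖ₑ ≤ K + K * L * φ y ‖f y‖₊ := by
    -- The infimum defining `φ⁻¹(y,1) ≤ 1/b` need not be attained, so `K = 2/b` lies strictly above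
    -- it and gives `φ(y,K) ≥ 1`. Beyond `K`, almost monotonicity of `φ(y,s)/s` forces at least
    -- linear growth.
    filter_upwards [hb, ae_restrict_mem hΩ] with y hy hyΩ
    rcases le_or_gt ‖f y‖₊ K with h | h
    · exact le_add_right (by rw [enorm_eq_nnnorm]; exact_mod_cast h)
    · refine le_add_left ?_
      have h1 : 1 ≤ φ y K := by
        refine le_of_genInv_lt (hφ.mono y hyΩ) (hy.2.trans_lt ?_)
        rw [hK, ENNReal.coe_div hb0.ne']
        refine ENNReal.div_lt_div_right (by exact_mod_cast hb0.ne') ENNReal.coe_ne_top (by norm_num)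
      have h2 := hL y hyΩ K _ hK0 h
      have hf0 : (‖f y‖₊ : ℝ≥0∞) ≠ 0 := by exact_mod_cast (hK0.trans h).ne'
      have hK0' : (K : ℝ≥0∞) ≠ 0 := by exact_mod_cast hK0.ne'
      have h3 : (1 : ℝ≥0∞) / K ≤ L * (φ y ‖f y‖₊ / ‖f y‖₊) := le_trans (by gcongr) h2
      rw [ENNReal.div_le_iff hK0' ENNReal.coe_ne_top] at h3
      rw [enorm_eq_nnnorm]
      calc (‖f y‖₊ : ℝ≥0∞) = 1 * ‖f y‖₊ := (one_mul _).symm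
        _ ≤ L * (φ y ‖f y‖₊ / ‖f y‖₊) * K * ‖f y‖₊ := by gcongr
        _ = K * L * (φ y ‖f y‖₊ / ‖f y‖₊ * ‖f y‖₊) := by ring
        _ = _ := by rw [ENNReal.div_mul_cancel hf0 ENNReal.coe_ne_top]
  calc _ ≤ ∫⁻ y in Ω, (K + K * L * φ y ‖f y‖₊) := lintegral_mono_ae hpt
    _ = K * volume Ω + K * L * modular Ω φ f := by
        rw [lintegral_add_left measurable_const, setLIntegral_const,
          lintegral_const_mul' _ _ (by finiteness), modular]
    _ ≤ K * volume Ω + K * L * 1 := by gcongr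
    _ = _ := by
        push_cast
        rw [ENNReal.coe_toNNReal hΩt, mul_one]

/-! ### The Jensen-type inequality on small balls -/

/-- The pointwise key estimate on a small ball. -/
lemma ae_le_of_mul_lt_average {Ω : Set (Rn n)} (hΩ : MeasurableSet Ω)
    {φ : Rn n → ℝ≥0 → ℝ≥0∞} (hφ : IsWeakPhi Ω φ) (hA0 : CondA0 Ω φ) (hA1 : CondA1 Ω φ)
    {p : ℝ} (hp : 1 < p) {t₀ a : ℝ≥0}
    (hInc : ∀ᵐ x ∂(volume.restrict Ω), ∀ t s : ℝ≥0, t₀ ≤ t → 0 < t → t < s →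
      φ x t * (s : ℝ≥0∞) ^ p ≤ a * (φ x s * (t : ℝ≥0∞) ^ p)) :
    ∃ C : ℝ≥0, ∀ f : Rn n → ℝ, AEMeasurable f (volume.restrict Ω) → modular Ω φ f ≤ 1 →
      ∀ (c : Rn n) (r : ℝ), 0 < r → volume (Metric.ball c r) ≤ 1 →
        ∀ᵐ x ∂(volume.restrict (Metric.ball c r ∩ Ω)), ∀ τ : ℝ≥0,
          C * τ < (volume (Metric.ball c r))⁻¹ * ∫⁻ y in Metric.ball c r ∩ Ω, ‖f y‖ₑ →
          φ x τ ≤ 1 + ((volume (Metric.ball c r))⁻¹ *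
            ∫⁻ y in Metric.ball c r ∩ Ω, φ y ‖f y‖₊ ^ (1 / p)) ^ p := by
  obtain ⟨b₀, hb₀, -, hb₀'⟩ := hA0
  obtain ⟨b, hb, -, hA1⟩ := hA1
  have hp0 : 0 < p := by linarith
  have hp1 : 0 ≤ 1 / p := by positivity
  refine ⟨(1 + a ^ (1 / p)) * (2 / b + t₀ / b₀), fun f hf hmod c r hr hvol => ?_⟩
  set B := Metric.ball c r with hB
  have hBm : MeasurableSet B := Metric.isOpen_ball.measurableSet
  have hv0 : volume B ≠ 0 := volume_ball_ne_zero c hr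
  have hvt : volume B ≠ ∞ := volume_ball_ne_top c r
  set A : ℝ≥0∞ := (volume B)⁻¹ * ∫⁻ y in B ∩ Ω, φ y ‖f y‖₊ ^ (1 / p) with hA
  have hsub : volume.restrict (B ∩ Ω) ≤ volume.restrict Ω :=
    Measure.restrict_mono inter_subset_right le_rfl
  have hgm : AEMeasurable (fun y => φ y ‖f y‖₊ ^ (1 / p)) (volume.restrict Ω) :=
    (hφ.measurable_comp f hf).pow_const _
  have hAp : A ^ p ≤ 1 / volume B := by
    have hpow : ∀ y, (Ω.indicator (fun y => φ y ‖f y‖₊ ^ (1 / p)) y) ^ p =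
        Ω.indicator (fun y => φ y ‖f y‖₊) y := by
      intro y
      by_cases hy : y ∈ Ω
      · simp only [indicator_of_mem hy]
        rw [← ENNReal.rpow_mul, one_div_mul_cancel hp0.ne', ENNReal.rpow_one]
      · simp [hy, hp0]
    have hfin : IsFiniteMeasure (volume.restrict B) :=
      ⟨by rw [Measure.restrict_apply_univ]; exact lt_top_iff_ne_top.2 hvt⟩
    have hj := rpow_average_le (volume.restrict B)
      (by rwa [Measure.restrict_apply_univ]) hp
      (g := Ω.indicator (fun y => φ y ‖f y‖₊ ^ (1 / p)))
      ((aemeasurable_indicator_iff hΩ).2 hgm).restrict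
    simp_rw [hpow] at hj
    rw [Measure.restrict_apply_univ, setLIntegral_indicator hΩ, setLIntegral_indicator hΩ,
      inter_comm Ω B] at hj
    refine hj.trans ?_
    rw [one_div]
    calc _ ≤ (volume B)⁻¹ * modular Ω φ f := by
          gcongr
          exact lintegral_mono' hsub le_rfl
      _ ≤ (volume B)⁻¹ * 1 := by gcongr
      _ = _ := mul_one _
  -- This level lies in the range of (A1) and depends on `f` and the ball but not on `x`, so (A1) is
  -- used at one level only.
  set t : ℝ≥0∞ := max 1 (A ^ p) with ht
  have ht1 : 1 ≤ t := le_max_left _ _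
  have htv : t ≤ 1 / volume B := max_le (by rw [one_div]; exact ENNReal.one_le_inv.2 hvol) hAp
  have htt : t ≠ ∞ := (htv.trans_lt (by
    rw [one_div]; exact ENNReal.inv_lt_top.2 (pos_iff_ne_zero.2 hv0))).ne
  have htle : t ≤ 1 + A ^ p := max_le (le_add_right le_rfl) (le_add_left le_rfl)
  have htp0 : t ^ (1 / p) ≠ 0 := (zero_lt_one.trans_le (ENNReal.one_le_rpow ht1 (by positivity))).ne'
  have htpt : t ^ (1 / p) ≠ ∞ := ENNReal.rpow_ne_top_of_nonneg hp1 htt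
  have hAt : A ≤ t ^ (1 / p) := by
    calc A = (A ^ p) ^ (1 / p) := by
          rw [← ENNReal.rpow_mul, mul_one_div_cancel hp0.ne', ENNReal.rpow_one]
      _ ≤ _ := ENNReal.rpow_le_rpow (le_max_right _ _) hp1
  have hsw := ae_ae_mul_le_swap (hA1 c r hr hvol t ht1 htv)
  filter_upwards [hsw, ae_mono hsub hb₀', ae_restrict_mem (hBm.inter hΩ)] with x hx hx0 hxm τ hτ
  refine le_trans (lt_of_lt_genInv ?_).le htle
  have hGt : genInv φ x t ≠ ∞ := genInv_ne_top (hφ.tendsto_top x hxm.2) htt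
  have hG0 : (b₀ : ℝ≥0∞) ≤ genInv φ x t := hx0.1.trans (genInv_mono ht1)
  obtain ⟨G, hG⟩ : ∃ G : ℝ≥0, (G : ℝ≥0∞) = genInv φ x t := ⟨_, ENNReal.coe_toNNReal hGt⟩
  rw [← hG] at hx hG0 ⊢
  have hbG : b₀ ≤ G := by exact_mod_cast hG0
  have hG0' : 0 < G := hb₀.trans_le hbG
  -- A threshold strictly above `φ⁻¹(y,t)`, so that `φ(y,T) ≥ t`, and at least `t₀`, so that (aInc)
  -- applies beyond it. As `G ≥ b₀` by (A0), it is still a multiple of `G`.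
  set T : ℝ≥0 := 2 * G / b + t₀ with hT
  have hT0 : 0 < T := by positivity
  have hTG : T ≤ (2 / b + t₀ / b₀) * G := by
    rw [hT, add_mul, div_mul_eq_mul_div]
    gcongr
    rw [div_mul_eq_mul_div, le_div_iff₀ hb₀]
    gcongr
  have hpt : ∀ᵐ y ∂(volume.restrict (B ∩ Ω)), ‖f y‖ₑ ≤
      T + (a : ℝ≥0∞) ^ (1 / p) * T * (t ^ (1 / p))⁻¹ * φ y ‖f y‖₊ ^ (1 / p) := by
    filter_upwards [hx, ae_mono hsub hInc, ae_restrict_mem (hBm.inter hΩ)] with y hy hyI hym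
    rw [enorm_eq_nnnorm]
    rcases le_or_gt ‖f y‖₊ T with h | h
    · exact le_add_right (by exact_mod_cast h)
    refine le_add_left ?_
    have hφT : t ≤ φ y T := by
      refine le_of_genInv_lt (hφ.mono y hym.2) ?_
      have hbe : (b : ℝ≥0∞) ≠ 0 := by exact_mod_cast hb.ne'
      have h1 : genInv φ y t ≤ ((G / b : ℝ≥0) : ℝ≥0∞) := by
        rw [ENNReal.coe_div hb.ne', ENNReal.le_div_iff_mul_le (Or.inl hbe)
          (Or.inl ENNReal.coe_ne_top), mul_comm]
        exact hy
      refine h1.trans_lt (ENNReal.coe_lt_coe.2 ?_)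
      have h2 : 0 < G / b := by positivity
      calc G / b < G / b + G / b := lt_add_of_pos_left _ h2
        _ = 2 * G / b := by rw [← two_mul, mul_div_assoc]
        _ ≤ T := le_add_right le_rfl
    have h1 := hyI T ‖f y‖₊ (le_add_left le_rfl) hT0 h
    have h2 : t * (‖f y‖₊ : ℝ≥0∞) ^ p ≤ a * (φ y ‖f y‖₊ * (T : ℝ≥0∞) ^ p) :=
      le_trans (by gcongr) h1
    have h3 := ENNReal.rpow_le_rpow h2 hp1
    simp only [ENNReal.mul_rpow_of_nonneg _ _ hp1, ← ENNReal.rpow_mul, mul_one_div_cancel hp0.ne',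
      ENNReal.rpow_one] at h3
    calc (‖f y‖₊ : ℝ≥0∞) = (t ^ (1 / p))⁻¹ * (t ^ (1 / p) * ‖f y‖₊) := by
          rw [← mul_assoc, ENNReal.inv_mul_cancel htp0 htpt, one_mul]
      _ ≤ (t ^ (1 / p))⁻¹ * (a ^ (1 / p) * (φ y ‖f y‖₊ ^ (1 / p) * T)) := by gcongr
      _ = _ := by ring
  have hcoe : (((1 + a ^ (1 / p)) * (2 / b + t₀ / b₀) : ℝ≥0) : ℝ≥0∞) =
      (1 + (a : ℝ≥0∞) ^ (1 / p)) * ((2 / b + t₀ / b₀ : ℝ≥0) : ℝ≥0∞) := by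
    rw [ENNReal.coe_mul, ENNReal.coe_add, ENNReal.coe_rpow_of_nonneg _ hp1, ENNReal.coe_one]
  have havg : (volume B)⁻¹ * ∫⁻ y in B ∩ Ω, ‖f y‖ₑ ≤
      (((1 + a ^ (1 / p)) * (2 / b + t₀ / b₀) : ℝ≥0) : ℝ≥0∞) * G := by
    calc _ ≤ (volume B)⁻¹ * ∫⁻ y in B ∩ Ω, (T + (a : ℝ≥0∞) ^ (1 / p) * T * (t ^ (1 / p))⁻¹ *
            φ y ‖f y‖₊ ^ (1 / p)) := mul_le_mul_right (lintegral_mono_ae hpt) _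
      _ = (volume B)⁻¹ * (T * volume (B ∩ Ω)) + (a : ℝ≥0∞) ^ (1 / p) * T * (t ^ (1 / p))⁻¹ * A := by
          rw [lintegral_add_left measurable_const, setLIntegral_const, lintegral_const_mul', mul_add,
            hA]
          · ring
          · exact ENNReal.mul_ne_top (ENNReal.mul_ne_top
              (ENNReal.rpow_ne_top_of_nonneg hp1 ENNReal.coe_ne_top) ENNReal.coe_ne_top)
              (ENNReal.inv_ne_top.2 htp0)
      _ ≤ (volume B)⁻¹ * (T * volume B) +
          (a : ℝ≥0∞) ^ (1 / p) * T * (t ^ (1 / p))⁻¹ * t ^ (1 / p) := by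
          gcongr; exact inter_subset_left
      _ = (1 + (a : ℝ≥0∞) ^ (1 / p)) * T := by
          rw [mul_assoc _ _ (t ^ (1 / p)), ENNReal.inv_mul_cancel htp0 htpt, mul_left_comm,
            ENNReal.inv_mul_cancel hv0 hvt]
          ring
      _ ≤ (1 + (a : ℝ≥0∞) ^ (1 / p)) * (((2 / b + t₀ / b₀) * G : ℝ≥0) : ℝ≥0∞) := by
          gcongr
      _ = _ := by rw [hcoe, ENNReal.coe_mul, mul_assoc]
  exact lt_of_mul_lt_mul_left' (hτ.trans_le havg)

/-! ### From single balls to the maximal function -/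

lemma lt_maximalFn_iff {Ω : Set (Rn n)} {f : Rn n → ℝ} {x : Rn n} {l : ℝ≥0∞} :
    l < maximalFn Ω f x ↔ ∃ (c : Rn n) (r : ℝ), x ∈ Metric.ball c r ∧
      l < (volume (Metric.ball c r))⁻¹ * ∫⁻ y in Metric.ball c r ∩ Ω, ‖f y‖ₑ := by
  simp only [maximalFn, lt_iSup_iff, exists_prop]

lemma measurable_maximalFn (Ω : Set (Rn n)) (f : Rn n → ℝ) : Measurable (maximalFn Ω f) := by
  refine measurable_of_Ioi fun l => (IsOpen.measurableSet ?_)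
  rw [isOpen_iff_mem_nhds]
  intro x hx
  obtain ⟨c, r, hxc, h⟩ := lt_maximalFn_iff.1 hx
  filter_upwards [Metric.isOpen_ball.mem_nhds hxc] with y hy
  exact lt_maximalFn_iff.2 ⟨c, r, hy, h⟩

lemma maximalFn_const_mul (Ω : Set (Rn n)) (k : ℝ) (f : Rn n → ℝ) (x : Rn n) :
    maximalFn Ω (fun y => k * f y) x = ‖k‖ₑ * maximalFn Ω f x := by
  simp only [maximalFn, ENNReal.mul_iSup, enorm_mul]
  refine iSup_congr fun c => iSup_congr fun r => iSup_congr fun _ => ?_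
  rw [lintegral_const_mul' _ _ enorm_ne_top, mul_left_comm]

lemma exists_pos_volume_ball_le_one (hn : 1 ≤ n) :
    ∃ R : ℝ, 0 < R ∧ ∀ (c : Rn n) (r : ℝ), r ≤ R → volume (Metric.ball c r) ≤ 1 := by
  set v : ℝ := (volume (Metric.ball (0 : Rn n) 1)).toReal with hv
  have hv0 : 0 ≤ v := ENNReal.toReal_nonneg
  have hR : 0 < (v + 1)⁻¹ := by positivity
  refine ⟨(v + 1)⁻¹, hR, fun c r hr => ?_⟩
  calc volume (Metric.ball c r) ≤ volume (Metric.ball c (v + 1)⁻¹) :=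
        measure_mono (Metric.ball_subset_ball hr)
    _ = ENNReal.ofReal ((v + 1)⁻¹ ^ n * v) := by
        rw [volume_ball_eq c hR, ENNReal.ofReal_mul (by positivity), hv,
          ENNReal.ofReal_toReal (volume_ball_ne_top _ _)]
    _ ≤ 1 := by
        rw [ENNReal.ofReal_le_one]
        have h1 : (v + 1)⁻¹ ^ n ≤ (v + 1)⁻¹ :=
          pow_le_of_le_one hR.le (inv_le_one_of_one_le₀ (by linarith)) (by omega)
        calc (v + 1)⁻¹ ^ n * v ≤ (v + 1)⁻¹ * v := by gcongr
          _ ≤ 1 := by rw [inv_mul_le_iff₀ (by positivity)]; linarith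

lemma volume_ball_ge (c : Rn n) {R r : ℝ} (hr : R ≤ r) :
    volume (Metric.ball (0 : Rn n) R) ≤ volume (Metric.ball c r) := by
  rw [← Measure.addHaar_ball_center volume c R]
  exact measure_mono (Metric.ball_subset_ball hr)

/-- On large balls averages are controlled by the total integral. -/
lemma average_le_of_le_radius (Ω : Set (Rn n)) (f : Rn n → ℝ) {C : ℝ≥0∞}
    (hf : ∫⁻ y in Ω, ‖f y‖ₑ ≤ C) (c : Rn n) {R r : ℝ} (hr : R ≤ r) :
    (volume (Metric.ball c r))⁻¹ * ∫⁻ y in Metric.ball c r ∩ Ω, ‖f y‖ₑ ≤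
      (volume (Metric.ball (0 : Rn n) R))⁻¹ * C := by
  refine mul_le_mul' (ENNReal.inv_le_inv.2 (volume_ball_ge c hr)) (le_trans ?_ hf)
  exact lintegral_mono' (Measure.restrict_mono inter_subset_right le_rfl) le_rfl

lemma ae_maximalFn_lt_top {Ω : Set (Rn n)} (hΩ : MeasurableSet Ω) (f : Rn n → ℝ)
    (hf : ∫⁻ y in Ω, ‖f y‖ₑ ≠ ∞) : ∀ᵐ x, maximalFn Ω f x < ∞ := by
  have hi : ∫⁻ y, Ω.indicator (fun y => ‖f y‖ₑ) y ≠ ∞ := by rwa [lintegral_indicator hΩ]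
  filter_upwards [ae_localMax_lt_top 1 hi] with x hx
  have hle : maximalFn Ω f x ≤ max (localMax 1 (Ω.indicator fun y => ‖f y‖ₑ) x)
      ((volume (Metric.ball (0 : Rn n) 1))⁻¹ * ∫⁻ y in Ω, ‖f y‖ₑ) := by
    refine iSup₂_le fun c r => iSup_le fun hxc => ?_
    rcases le_total r 1 with h | h
    · refine le_max_of_le_left ((le_localMax _ h hxc).trans' ?_)
      rw [setLIntegral_indicator hΩ, inter_comm]
    · exact le_max_of_le_right (average_le_of_le_radius Ω f le_rfl c h)
  exact hle.trans_lt (max_lt hx (ENNReal.mul_lt_top (ENNReal.inv_lt_top.2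
    (Metric.measure_ball_pos volume _ one_pos)) (lt_top_iff_ne_top.2 hf)))

/-- Every ball lies in a comparable ball with centre in a dense set and rational radius. -/
lemma exists_ball_superset {D : Set (Rn n)} (hD : Dense D) (c : Rn n) {r : ℝ} (hr : 0 < r) :
    ∃ d ∈ D, ∃ q : ℚ, Metric.ball c r ⊆ Metric.ball d q ∧ 0 < (q : ℝ) ∧
      (volume (Metric.ball c r))⁻¹ ≤
        ENNReal.ofReal (2 ^ n) * (volume (Metric.ball d (q : ℝ)))⁻¹ := by
  obtain ⟨d, hd, hdD⟩ := Metric.dense_iff.1 hD c (r / 2) (by positivity)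
  obtain ⟨q, hq1, hq2⟩ := exists_rat_btwn (show 3 / 2 * r < 2 * r by linarith)
  have hq0 : 0 < (q : ℝ) := by linarith
  refine ⟨d, hdD, q, Metric.ball_subset_ball' ?_, hq0, ?_⟩
  · rw [dist_comm]; have := Metric.mem_ball.1 hd; linarith
  · have h2 : volume (Metric.ball d (q : ℝ)) ≤ ENNReal.ofReal (2 ^ n) * volume (Metric.ball c r) := by
      rw [volume_ball_eq d hq0, volume_ball_eq c hr, ← mul_assoc,
        ← ENNReal.ofReal_mul (by positivity), ← mul_pow]
      gcongr
    rw [← div_eq_mul_inv, ENNReal.le_div_iff_mul_le (Or.inl (volume_ball_ne_zero d hq0))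
      (Or.inl (volume_ball_ne_top d _)), mul_comm, ← div_eq_mul_inv]
    exact ENNReal.div_le_of_le_mul h2

/-- Stating the bound for each `τ` with `K * τ < Mf(x)` means that one ball witnesses the strict
inequality; no limit along balls, hence no continuity of `φ x`, is required. -/
lemma ae_le_of_mul_lt_maximalFn (hn : 1 ≤ n) {Ω : Set (Rn n)} (hΩ : MeasurableSet Ω)
    (hΩt : volume Ω ≠ ∞)
    {φ : Rn n → ℝ≥0 → ℝ≥0∞} (hφ : IsWeakPhi Ω φ) (hA0 : CondA0 Ω φ) (hA1 : CondA1 Ω φ)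
    {p : ℝ} (hp : 1 < p) {t₀ a : ℝ≥0}
    (hInc : ∀ᵐ x ∂(volume.restrict Ω), ∀ t s : ℝ≥0, t₀ ≤ t → 0 < t → t < s →
      φ x t * (s : ℝ≥0∞) ^ p ≤ a * (φ x s * (t : ℝ≥0∞) ^ p)) :
    ∃ (K : ℝ≥0) (R : ℝ), ∀ f : Rn n → ℝ, AEMeasurable f (volume.restrict Ω) →
      modular Ω φ f ≤ 1 → ∀ᵐ x ∂(volume.restrict Ω), ∀ τ : ℝ≥0, K * τ < maximalFn Ω f x →
        φ x τ ≤ 1 + localMax R (Ω.indicator fun y => φ y ‖f y‖₊ ^ (1 / p)) x ^ p := by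
  have hp0 : 0 < p := by linarith
  obtain ⟨C₁, hC₁⟩ := ae_le_of_mul_lt_average hΩ hφ hA0 hA1 hp hInc
  obtain ⟨C₀, hC₀⟩ := lintegral_enorm_le_of_modular_le_one hΩ hΩt hφ hA0
  obtain ⟨b, hb, -, hb'⟩ := hA0
  obtain ⟨R, hR, hRv⟩ := exists_pos_volume_ball_le_one hn
  obtain ⟨D, hDc, hD⟩ := TopologicalSpace.exists_countable_dense (Rn n)
  have hv0 : (volume (Metric.ball (0 : Rn n) R))⁻¹ ≠ ∞ :=
    ENNReal.inv_ne_top.2 (volume_ball_ne_zero 0 hR)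
  set C₂ : ℝ≥0 := ((volume (Metric.ball (0 : Rn n) R))⁻¹ * C₀).toNNReal with hC₂
  have hC₂' : (volume (Metric.ball (0 : Rn n) R))⁻¹ * C₀ = C₂ :=
    (ENNReal.coe_toNNReal (ENNReal.mul_ne_top hv0 ENNReal.coe_ne_top)).symm
  -- The factor `2 ^ n` pays for enlarging to a ball of the countable family, `C₁` serves radii up
  -- to `R`, and `C₂ / b` serves larger ones.
  refine ⟨2 ^ n * max C₁ (C₂ / b), R, fun f hf hmod => ?_⟩
  have hball : ∀ᵐ x ∂(volume.restrict Ω), ∀ d ∈ D, ∀ q : ℚ, 0 < (q : ℝ) → (q : ℝ) ≤ R →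
      x ∈ Metric.ball d (q : ℝ) → ∀ τ : ℝ≥0,
          C₁ * τ < (volume (Metric.ball d (q : ℝ)))⁻¹ *
            ∫⁻ y in Metric.ball d (q : ℝ) ∩ Ω, ‖f y‖ₑ →
          φ x τ ≤ 1 + ((volume (Metric.ball d (q : ℝ)))⁻¹ *
            ∫⁻ y in Metric.ball d (q : ℝ) ∩ Ω, φ y ‖f y‖₊ ^ (1 / p)) ^ p := by
    rw [ae_ball_iff hDc]
    intro d _
    rw [ae_all_iff]
    intro q
    by_cases hq : 0 < (q : ℝ) ∧ (q : ℝ) ≤ R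
    · have h := hC₁ f hf hmod d q hq.1 (hRv d q hq.2)
      rw [← Measure.restrict_restrict Metric.isOpen_ball.measurableSet,
        ae_restrict_iff' Metric.isOpen_ball.measurableSet] at h
      filter_upwards [h] with x hx _ _
      simpa only [Measure.restrict_restrict Metric.isOpen_ball.measurableSet] using hx
    · exact Eventually.of_forall fun x h1 h2 => absurd ⟨h1, h2⟩ hq
  filter_upwards [hball, hb'] with x hx hxb τ hτ
  obtain ⟨c, r, hxc, hlt⟩ := lt_maximalFn_iff.1 hτ
  obtain ⟨d, hd, q, hsub, hq0, hq⟩ := exists_ball_superset hD c (Metric.pos_of_mem_ball hxc)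
  have h2n : ENNReal.ofReal (2 ^ n) = 2 ^ n := by
    rw [ENNReal.ofReal_pow (by norm_num)]; norm_num
  have hlt' : (max C₁ (C₂ / b) : ℝ≥0) * (τ : ℝ≥0∞) < (volume (Metric.ball d (q : ℝ)))⁻¹ *
      ∫⁻ y in Metric.ball d (q : ℝ) ∩ Ω, ‖f y‖ₑ := by
    refine lt_of_mul_lt_mul_left' (a := (2 : ℝ≥0∞) ^ n) ?_
    calc (2 : ℝ≥0∞) ^ n * ((max C₁ (C₂ / b) : ℝ≥0) * (τ : ℝ≥0∞))
        = ((2 ^ n * max C₁ (C₂ / b) : ℝ≥0) : ℝ≥0∞) * τ := by push_cast; ring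
      _ < _ := hlt
      _ ≤ (ENNReal.ofReal (2 ^ n) * (volume (Metric.ball d (q : ℝ)))⁻¹) *
          ∫⁻ y in Metric.ball d (q : ℝ) ∩ Ω, ‖f y‖ₑ :=
        mul_le_mul' hq (lintegral_mono' (Measure.restrict_mono
          (inter_subset_inter_left _ hsub) le_rfl) le_rfl)
      _ = _ := by rw [h2n, mul_assoc]
  rcases le_or_gt (q : ℝ) R with hqR | hqR
  · refine (hx d hd q hq0 hqR (hsub hxc) τ (lt_of_le_of_lt ?_ hlt')).trans ?_
    · gcongr; exact le_max_left _ _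
    · gcongr
      refine (le_localMax _ hqR (hsub hxc)).trans' ?_
      rw [setLIntegral_indicator hΩ, inter_comm]
  -- On a large ball the average is at most `C₂`, which forces `τ < b ≤ φ⁻¹(x,1)` and hence `φ(x,τ)
  -- < 1`.
  · refine le_add_right (lt_of_lt_genInv (t := 1) (lt_of_lt_of_le ?_ hxb.1)).le
    have h1 := hlt'.trans_le (average_le_of_le_radius Ω f (hC₀ f hmod) d hqR.le)
    rw [hC₂', ← ENNReal.coe_mul, ENNReal.coe_lt_coe] at h1
    rw [ENNReal.coe_lt_coe]
    by_contra! h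
    refine absurd h1 (not_lt.2 ?_)
    calc C₂ = C₂ / b * b := (div_mul_cancel₀ _ hb.ne').symm
      _ ≤ _ := by gcongr; exact le_max_right _ _

/-! ### Modular estimates and passage to the norm -/

lemma exists_modular_smul_le {Ω : Set (Rn n)} (hΩ : MeasurableSet Ω) {φ : Rn n → ℝ≥0 → ℝ≥0∞}
    (hφ : IsWeakPhi Ω φ) : ∃ L : ℝ≥0, ∀ (f : Rn n → ℝ) (ε : ℝ≥0), ε < 1 →
      modular Ω φ (fun x => ε * f x) ≤ L * ε * modular Ω φ f := by
  obtain ⟨L, -, hL⟩ := hφ.almost_increasing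
  refine ⟨L, fun f ε hε => ?_⟩
  rw [modular, modular, ← lintegral_const_mul' _ _ (by finiteness)]
  refine setLIntegral_mono' hΩ fun x hx => ?_
  have hn : ‖(ε : ℝ) * f x‖₊ = ε * ‖f x‖₊ := by simp
  rw [hn]
  rcases eq_or_lt_of_le (zero_le (a := ε * ‖f x‖₊)) with h | h
  · rw [← h, hφ.map_zero x hx]; exact zero_le
  · have hf0 : 0 < ‖f x‖₊ := pos_of_mul_pos_right h zero_le
    have h1 := hL x hx _ _ h (mul_lt_of_lt_one_left hf0 hε)
    have hf0' : (‖f x‖₊ : ℝ≥0∞) ≠ 0 := by exact_mod_cast hf0.ne'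
    rw [ENNReal.div_le_iff (by exact_mod_cast h.ne') ENNReal.coe_ne_top] at h1
    calc _ ≤ _ := h1
      _ = L * ε * (φ x ‖f x‖₊ / ‖f x‖₊ * ‖f x‖₊) := by push_cast; ring
      _ = _ := by rw [ENNReal.div_mul_cancel hf0' ENNReal.coe_ne_top]

lemma exists_modular_smul_le_one {Ω : Set (Rn n)} (hΩ : MeasurableSet Ω)
    {φ : Rn n → ℝ≥0 → ℝ≥0∞} (hφ : IsWeakPhi Ω φ) (Q : ℝ≥0) :
    ∃ ε : ℝ≥0, 0 < ε ∧ ∀ f : Rn n → ℝ, modular Ω φ f ≤ Q →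
      modular Ω φ (fun x => ε * f x) ≤ 1 := by
  obtain ⟨L, hL⟩ := exists_modular_smul_le hΩ hφ
  -- The summand 2 keeps the factor strictly below 1 even when `L * Q = 0`.
  refine ⟨(L * Q + 2)⁻¹, by positivity, fun f hf => ?_⟩
  have h1 : (L * Q + 2)⁻¹ < 1 := by
    apply inv_lt_one_of_one_lt₀
    exact lt_of_lt_of_le (by norm_num) (le_add_left le_rfl)
  calc _ ≤ _ := hL f _ h1
    _ ≤ L * ((L * Q + 2)⁻¹ : ℝ≥0) * Q := by gcongr
    _ = ((L * Q / (L * Q + 2) : ℝ≥0) : ℝ≥0∞) := by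
        rw [← ENNReal.coe_mul, ← ENNReal.coe_mul]; congr 1; ring
    _ ≤ 1 := by
        rw [ENNReal.coe_le_one_iff]
        exact div_le_one_of_le₀ (le_add_right le_rfl) zero_le

/-- The modular form of the boundedness of the maximal operator. -/
lemma exists_modular_maximalFn_le_one (hn : 1 ≤ n) {Ω : Set (Rn n)} (hΩ : MeasurableSet Ω)
    (hΩt : volume Ω ≠ ∞) {φ : Rn n → ℝ≥0 → ℝ≥0∞} (hφ : IsWeakPhi Ω φ) (hA0 : CondA0 Ω φ)
    (hA1 : CondA1 Ω φ) (hInc : AIncInfty Ω φ) :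
    ∃ θ : ℝ≥0, 0 < θ ∧ ∀ f : Rn n → ℝ, AEMeasurable f (volume.restrict Ω) →
      modular Ω φ f ≤ 1 → modular Ω φ (fun x => θ * (maximalFn Ω f x).toReal) ≤ 1 := by
  obtain ⟨t₀, p, hp, hI⟩ := hInc
  have hp0 : 0 < p := by linarith
  obtain ⟨a, ha⟩ := ae_aInc hΩ hφ hp0 hI
  obtain ⟨K, R, hK⟩ := ae_le_of_mul_lt_maximalFn hn hΩ hΩt hφ hA0 hA1 hp ha
  obtain ⟨C, hC⟩ := strong_type (n := n) hp
  obtain ⟨ε, hε, hεm⟩ := exists_modular_smul_le_one hΩ hφ ((volume Ω).toNNReal + C)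
  -- Then `K * k < 1`, so `τ = k * Mf(x)` meets the strict hypothesis whenever `Mf(x)` is positive
  -- and finite; otherwise `τ = 0`.
  set k : ℝ≥0 := (K + 1)⁻¹ with hk
  have hk0 : 0 < k := by positivity
  refine ⟨ε * k, by positivity, fun f hf hmod => ?_⟩
  set g : Rn n → ℝ≥0∞ := Ω.indicator fun y => φ y ‖f y‖₊ ^ (1 / p) with hg
  have hφm := hφ.measurable_comp f hf
  have hgm : AEMeasurable g := (aemeasurable_indicator_iff hΩ).2 (hφm.pow_const _)
  -- `strong_type` requires an integrable function; here `g ≤ 1 + φ(·,|f|)` on the finite-measure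
  -- set `Ω`.
  have hgi : ∫⁻ y, g y ≠ ∞ := by
    rw [hg, lintegral_indicator hΩ]
    refine (lt_of_le_of_lt (b := ∫⁻ y in Ω, (1 + φ y ‖f y‖₊)) (lintegral_mono fun y => ?_) ?_).ne
    · rcases le_total (φ y ‖f y‖₊) 1 with h | h
      · exact le_add_right (ENNReal.rpow_le_one h (by positivity))
      · refine le_add_left ?_
        calc _ ≤ φ y ‖f y‖₊ ^ (1 : ℝ) :=
              ENNReal.rpow_le_rpow_of_exponent_le h ((div_le_one hp0).2 hp.le)
          _ = _ := ENNReal.rpow_one _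
    · rw [lintegral_add_left measurable_const, setLIntegral_const, one_mul]
      exact ENNReal.add_lt_top.2 ⟨lt_top_iff_ne_top.2 hΩt, lt_of_le_of_lt hmod ENNReal.one_lt_top⟩
  have hgp : ∫⁻ y, g y ^ p = modular Ω φ f := by
    rw [modular, ← lintegral_indicator hΩ]
    congr 1 with y
    by_cases hy : y ∈ Ω
    · simp only [hg, indicator_of_mem hy]
      rw [← ENNReal.rpow_mul, one_div_mul_cancel hp0.ne', ENNReal.rpow_one]
    · simp [hg, hy, hp0]
  have hmain : modular Ω φ (fun x => k * (maximalFn Ω f x).toReal) ≤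
      ((volume Ω).toNNReal + C : ℝ≥0) := by
    have hpt : ∀ᵐ x ∂(volume.restrict Ω), φ x ‖(k : ℝ) * (maximalFn Ω f x).toReal‖₊ ≤
        1 + localMax R g x ^ p := by
      filter_upwards [hK f hf hmod, ae_restrict_mem hΩ] with x hx hxΩ
      have hnn : ‖(k : ℝ) * (maximalFn Ω f x).toReal‖₊ = k * (maximalFn Ω f x).toNNReal := by
        simp [ENNReal.toReal]
      rw [hnn]
      rcases eq_or_lt_of_le (zero_le (a := (maximalFn Ω f x).toNNReal)) with h | h
      · rw [← h, mul_zero, hφ.map_zero x hxΩ]; exact zero_le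
      · have hne : maximalFn Ω f x ≠ ∞ := fun h' => by simp [h'] at h
        refine hx _ ?_
        conv_rhs => rw [← ENNReal.coe_toNNReal hne]
        rw [← ENNReal.coe_mul, ENNReal.coe_lt_coe, ← mul_assoc]
        refine mul_lt_of_lt_one_left h ?_
        rw [hk, ← div_eq_mul_inv, div_lt_one (by positivity)]
        exact lt_add_of_pos_right _ one_pos
    calc _ ≤ ∫⁻ x in Ω, (1 + localMax R g x ^ p) := lintegral_mono_ae hpt
      _ = volume Ω + ∫⁻ x in Ω, localMax R g x ^ p := by
          rw [lintegral_add_left measurable_const, setLIntegral_const, one_mul]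
      _ ≤ volume Ω + C * ∫⁻ x, g x ^ p := by
          gcongr
          exact (setLIntegral_le_lintegral _ _).trans (hC R g hgm hgi)
      _ ≤ volume Ω + C * 1 := by rw [hgp]; gcongr
      _ = _ := by push_cast; rw [ENNReal.coe_toNNReal hΩt, mul_one]
  have := hεm _ hmain
  convert this using 2
  funext x
  push_cast; ring

theorem maximalBounded (hn : 1 ≤ n) {Ω : Set (Rn n)} (hΩ : IsOpen Ω)
    (hΩb : Bornology.IsBounded Ω) {φ : Rn n → ℝ≥0 → ℝ≥0∞}
    (hφ : IsWeakPhi Ω φ) (hA0 : CondA0 Ω φ) (hA1 : CondA1 Ω φ) (hInc : AIncInfty Ω φ) :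
    MaximalBounded Ω φ := by
  have hΩm : MeasurableSet Ω := hΩ.measurableSet
  have hΩt : volume Ω ≠ ∞ := hΩb.measure_lt_top.ne
  obtain ⟨θ, hθ, hmod⟩ := exists_modular_maximalFn_le_one hn hΩm hΩt hφ hA0 hA1 hInc
  obtain ⟨C₀, hC₀⟩ := lintegral_enorm_le_of_modular_le_one hΩm hΩt hφ hA0
  -- If `l` is admissible for `f`, homogeneity of the maximal operator makes `l * θ⁻¹` admissible
  -- for `Mf`.
  refine ⟨θ⁻¹, fun f hf => ?_⟩
  obtain ⟨hfm, lam, hlam, hfin⟩ := hf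
  obtain ⟨ε, hε, hεm⟩ := exists_modular_smul_le_one hΩm hφ (modular Ω φ fun x => lam * f x).toNNReal
  have h1 : modular Ω φ (fun x => ε * (lam * f x)) ≤ 1 :=
    hεm _ (by rw [ENNReal.coe_toNNReal hfin.ne])
  set k : ℝ := ε * lam with hk
  have hk0 : 0 < k := by positivity
  simp_rw [← mul_assoc, ← hk] at h1
  have hscale : ∀ l : ℝ, 0 < l → ∀ x, θ * (maximalFn Ω (fun y => l * f y) x).toReal =
      θ * l * (maximalFn Ω f x).toReal := by
    intro l hl x
    rw [maximalFn_const_mul, ENNReal.toReal_mul, mul_assoc]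
    simp [abs_of_pos hl]
  have hint : ∫⁻ y in Ω, ‖f y‖ₑ ≠ ∞ := by
    have h2 := hC₀ _ h1
    simp only [enorm_mul] at h2
    rw [lintegral_const_mul' _ _ enorm_ne_top] at h2
    intro h
    rw [h, ENNReal.mul_top (by simpa using hk0.ne')] at h2
    exact absurd h2 (by simp)
  refine ⟨?_, ae_restrict_of_ae (ae_maximalFn_lt_top hΩm f hint), ⟨?_, θ * k, by positivity, ?_⟩, ?_⟩
  · exact IntegrableOn.locallyIntegrableOn
      ⟨hfm.aestronglyMeasurable, hasFiniteIntegral_iff_enorm.2 (lt_top_iff_ne_top.2 hint)⟩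
  · exact (measurable_maximalFn Ω f).ennreal_toReal.aemeasurable
  · have h2 := hmod _ (hfm.const_mul k) h1
    simp_rw [hscale k hk0] at h2
    exact h2.trans_lt ENNReal.one_lt_top
  · have hθ0 : ((θ⁻¹ : ℝ≥0) : ℝ≥0∞) ≠ 0 := by exact_mod_cast (inv_pos.2 hθ).ne'
    -- Moving the constant across leaves a lower bound for the infimum, testable at each admissible
    -- `l`.
    rw [mul_comm, ← ENNReal.div_le_iff hθ0 ENNReal.coe_ne_top]
    refine le_iInf fun l => le_iInf fun hl => le_iInf fun hml => ?_
    rw [ENNReal.div_le_iff hθ0 ENNReal.coe_ne_top, ← ENNReal.coe_mul]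
    have hl' : (0 : ℝ) < (l : ℝ)⁻¹ := by positivity
    have hfl : (fun x => f x / (l : ℝ)) = fun x => (l : ℝ)⁻¹ * f x := by
      funext x; rw [div_eq_inv_mul]
    rw [hfl] at hml
    have h2 := hmod _ (hfm.const_mul _) hml
    simp_rw [hscale _ hl'] at h2
    refine iInf₂_le_of_le (l * θ⁻¹) (by positivity) (iInf_le_of_le ?_ le_rfl)
    convert h2 using 3
    push_cast
    field_simp

end GenOrlicz

theorem mainTheorem6 (n : ℕ) (hn : 1 ≤ n) (Ω : Set (GenOrlicz.Rn n)) (hΩ : IsOpen Ω)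
    (hΩb : Bornology.IsBounded Ω) (φ : GenOrlicz.Rn n → ℝ≥0 → ℝ≥0∞)
    (hφ : GenOrlicz.IsWeakPhi Ω φ) (hA0 : GenOrlicz.CondA0 Ω φ) (hA1 : GenOrlicz.CondA1 Ω φ)
    (hInc : GenOrlicz.AIncInfty Ω φ) :
    GenOrlicz.MaximalBounded Ω φ :=
  GenOrlicz.maximalBounded hn hΩ hΩb hφ hA0 hA1 hInc
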